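/- Let $(R,\mathfrak m)$ be a one-dimensional Noetherian local domain with infinite residue field and field of fractions $K$, such that the integral closure $\overline R$ of $R$ in $K$ is a finite $R$-module and a discrete valuation ring, and such that the natural map $R/\mathfrak m\to \overline R/\mathfrak m_{\overline R}$ is an isomorphism ($\mathfrak m_{\overline R}$ being the maximal ideal of $\overline R$). Assume that $\mathfrak m$ is not principal. For $R$-submodules $A,B\subseteq K$ put $A:B=\{z\in K : zB\subseteq A\}$, and let $\ell_R$ denote the length of an $R$-module. Let - $\gamma_R=R:\overline R$ be the conductor, $c=\ell_R(\overline R/\gamma_R)$ and $\delta=\ell_R(\overline R/R)$; - $\Lambda(\mathfrak m)=\bigcup_{n\ge 0}(\mathfrak m^n:\mathfrak m^n)$ be the blowing-up of $R$ along $\mathfrak m$; - $\mu=\ell_R(\mathfrak m/\mathfrak m^2)$ be the embedding dimension, and $e=h(1)$ the multiplicity of $R$, where $h$ is the polynomial with $\sum_{n\ge 0}\ell_R(\mathfrak m^n/\mathfrak m^{n+1})z^n=h(z)/(1-z)$; - $x\in\mathfrak m$ be a minimal reduction of $\mathfrak m$, that is, an element with $\mathfrak m^{n+1}=x\mathfrak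 m^n$ for all large $n$, and $\nu$ the reduction exponent, that is, the least integer $\nu\ge 0$ such that $\mathfrak m^{n+1}=x\mathfrak m^n$ for all $n\ge\nu$. Then the following conditions are equivalent: 1. $\gamma_R=\mathfrak m^2$; 2. $\Lambda(\mathfrak m)=\overline R$, $\ e-(\mu+1)=\tfrac12(2\delta-c)$, and $\nu=2$. -/

import Mathlib

noncomputable section

namespace BlowUp

open IsLocalRing Polynomial

section Length

variable {R M : Type*} [CommRing R] [AddCommGroup M] [Module R M]

/-- The length `l_R(N / P)` for submodules `P ≤ N` of a module, as a natural number
(every length used below is finite). -/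
def quotLength (N P : Submodule R M) : ℕ :=
  (Module.length R (N ⧸ P.submoduleOf N)).toNat

end Length

section Ideals

variable {R : Type*} [CommRing R]

/-- The Hilbert function `H_I(n) = l_R(I ^ n / I ^ (n + 1))`. -/
def hilbertFunction (I : Ideal R) (n : ℕ) : ℕ :=
  quotLength (I ^ n) (I ^ (n + 1))

/-- The Hilbert-Poincaré series `P_I(z) = ∑ H_I(n) z ^ n`. -/
def hilbertSeries (I : Ideal R) : PowerSeries ℤ :=
  PowerSeries.mk fun n => (hilbertFunction I n : ℤ)

open Classical in
/-- The `h`-polynomial of `I`: the polynomial `h` with `h(z) = (1 - z) P_I(z)`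
(it is unique when it exists; the value is `0` if there is none). -/
def hPolynomial (I : Ideal R) : ℤ[X] :=
  if H : ∃ h : ℤ[X], (h : PowerSeries ℤ) = (1 - PowerSeries.X) * hilbertSeries I
  then H.choose else 0

/-- The multiplicity `e(I) = h_I(1)`. -/
def multiplicity (I : Ideal R) : ℤ :=
  (hPolynomial I).eval 1

/-- `x ∈ I` is a minimal reduction of `I`: `I ^ (n + 1) = x I ^ n` for all large `n`. -/
def IsMinimalReduction (I : Ideal R) (x : R) : Prop :=
  x ∈ I ∧ ∃ N : ℕ, ∀ n ≥ N, I ^ (n + 1) = Ideal.span {x} * I ^ n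

/-- The reduction exponent of `I` with respect to the minimal reduction `x`:
the least `ν` such that `I ^ (n + 1) = x I ^ n` for all `n ≥ ν`. -/
def reductionExponent (I : Ideal R) (x : R) : ℕ :=
  sInf {ν : ℕ | ∀ n ≥ ν, I ^ (n + 1) = Ideal.span {x} * I ^ n}

variable (R) in
/-- The embedding dimension `μ = l_R(𝔪 / 𝔪 ^ 2)`. -/
def embDim [IsLocalRing R] : ℕ :=
  quotLength (maximalIdeal R) (maximalIdeal R ^ 2)

end Ideals

section Fractional

variable {R : Type*} (K : Type*) [CommRing R] [Field K] [Algebra R K]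

/-- An ideal of `R`, viewed as an `R`-submodule of `K`. -/
abbrev toK (I : Ideal R) : Submodule R K :=
  IsLocalization.coeSubmodule K I

variable (R) in
/-- The integral closure of `R` in `K`, as an `R`-submodule of `K`. -/
abbrev Rbar : Submodule R K :=
  Subalgebra.toSubmodule (integralClosure R K)

/-- The blowing-up `Λ(I) = ⋃ₙ (I ^ n : I ^ n)` of `R` along `I`, inside `K`.
Here `A / B` is Mathlib's `{z ∈ K | z B ⊆ A}`; the supremum of these submodules is their union,
see `coe_blowup`. -/
def blowup (I : Ideal R) : Submodule R K :=
  ⨆ n : ℕ, toK K (I ^ n) / toK K (I ^ n)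

theorem coe_blowup (I : Ideal R) :
    (blowup K I : Set K) = ⋃ n : ℕ, ((toK K (I ^ n) / toK K (I ^ n) : Submodule R K) : Set K) := by
  refine Submodule.coe_iSup_of_directed _ (Monotone.directed_le (monotone_nat_of_le_succ ?_))
  intro n z hz
  rw [Submodule.mem_div_iff_forall_mul_mem] at hz ⊢
  intro y hy
  simp only [toK, pow_succ, IsLocalization.coeSubmodule_mul] at hz hy ⊢
  induction hy using Submodule.mul_induction_on' with
  | mem_mul_mem a ha b hb =>
    rw [← mul_assoc]
    exact Submodule.mul_mem_mul (hz a ha) hb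
  | add a _ b _ iha ihb =>
    rw [mul_add]
    exact add_mem iha ihb

variable (R) in
/-- The conductor `γ_R = R : R̄ = {z ∈ K | z R̄ ⊆ R}`. -/
def conductor : Submodule R K :=
  1 / Rbar R K

variable (R) in
/-- `c = l_R(R̄ / γ_R)`. -/
def conductorExponent : ℕ :=
  quotLength (Rbar R K) (conductor R K)

variable (R) in
/-- The singularity degree `δ = l_R(R̄ / R)`. -/
def singularityDegree : ℕ :=
  quotLength (Rbar R K) 1

variable (R) in
/-- `R` is residually rational: the natural map from `R` to the residue field of `R̄` is
surjective, i.e. it induces an isomorphism of residue fields. -/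
def IsResiduallyRational [IsLocalRing (integralClosure R K)] : Prop :=
  Function.Surjective (algebraMap R (ResidueField (integralClosure R K)))

end Fractional

end BlowUp

end

/-!
Call `𝔪^k` stable if it equals `x^kR̄`. Since `𝔪^k ⊆ x^kR̄` always holds (the determinant trick),
`𝔪^k` is stable exactly when `Λ(𝔪) = R̄` and `ν ≤ k`, and `γ = 𝔪^k` makes it stable because `γ`
is an `R̄`-module containing `x^k`. So both conditions of the theorem make `𝔪²` stable. Then
`e = ℓ(R̄ / xR̄)`, whence `2e = ℓ(R̄ / 𝔪²) = μ + 1 + δ`, and the numerical condition says `c = 2e`,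
that is, that the inclusion `𝔪² ⊆ γ` is an equality. Finally, `γ = 𝔪²` excludes `ν < 2`:
otherwise `𝔪` is stable too, so `𝔪 = xR̄ ⊆ γ = 𝔪²`, against Nakayama.
-/

namespace BlowUp

open IsLocalRing Polynomial
open scoped Pointwise

section Length

variable {R M M' : Type*} [CommRing R] [AddCommGroup M] [Module R M] [AddCommGroup M'] [Module R M']

theorem length_quotient_add {P N L : Submodule R M} (hPN : P ≤ N) (hNL : N ≤ L) :
    Module.length R (L ⧸ P.submoduleOf L) =
      Module.length R (N ⧸ P.submoduleOf N) + Module.length R (L ⧸ N.submoduleOf L) := by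
  have hPN' : P.submoduleOf N ≤ (P.submoduleOf L).comap (Submodule.inclusion hNL) := fun _ hz => hz
  have hPNL : P.submoduleOf L ≤ N.submoduleOf L := fun _ hz => hPN hz
  refine Module.length_eq_add_of_exact (Submodule.mapQ _ _ (Submodule.inclusion hNL) hPN')
    (Submodule.factor hPNL) ?_ (Submodule.factor_surjective hPNL) ?_
  · rw [← LinearMap.ker_eq_bot, Submodule.ker_mapQ, eq_bot_iff, Submodule.map_le_iff_le_comap]
    exact fun _ hz => (Submodule.Quotient.mk_eq_zero _).2 hz
  · rw [LinearMap.exact_iff, Submodule.factor.eq_def, Submodule.ker_mapQ, Submodule.range_mapQ,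
      Submodule.range_inclusion]
    rfl

theorem length_quotient_ne_top_iff {P N L : Submodule R M} (hPN : P ≤ N) (hNL : N ≤ L) :
    Module.length R (L ⧸ P.submoduleOf L) ≠ ⊤ ↔
      Module.length R (N ⧸ P.submoduleOf N) ≠ ⊤ ∧ Module.length R (L ⧸ N.submoduleOf L) ≠ ⊤ := by
  rw [length_quotient_add hPN hNL, Ne, ENat.add_eq_top, not_or]

theorem quotLength_add {P N L : Submodule R M} (hPN : P ≤ N) (hNL : N ≤ L)
    (hfin : Module.length R (L ⧸ P.submoduleOf L) ≠ ⊤) :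
    quotLength L P = quotLength N P + quotLength L N := by
  obtain ⟨hfinPN, hfinNL⟩ := (length_quotient_ne_top_iff hPN hNL).1 hfin
  rw [quotLength, length_quotient_add hPN hNL, ENat.toNat_add hfinPN hfinNL, quotLength, quotLength]

theorem quotLength_eq_quotLength_iff {P N L : Submodule R M} (hPN : P ≤ N) (hNL : N ≤ L)
    (hfin : Module.length R (L ⧸ P.submoduleOf L) ≠ ⊤) :
    quotLength L P = quotLength L N ↔ P = N := by
  refine ⟨fun h => ?_, fun h => h ▸ rfl⟩
  have hzero : quotLength N P = 0 := by
    have := quotLength_add hPN hNL hfin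
    omega
  have hfinPN := ((length_quotient_ne_top_iff hPN hNL).1 hfin).1
  rw [quotLength, ENat.toNat_eq_zero, or_iff_left hfinPN, Module.length_eq_zero_iff,
    Submodule.Quotient.subsingleton_iff, Submodule.submoduleOf_eq_top] at hzero
  exact le_antisymm hPN hzero

theorem quotLength_eq_one_of_covBy {P N : Submodule R M} (h : P ⋖ N) : quotLength N P = 1 := by
  have : Module.length R (N ⧸ P.submoduleOf N) = 1 :=
    Module.length_eq_one_iff.2 ((covBy_iff_quot_is_simple h.le).1 h)
  rw [quotLength, this, ENat.toNat_one]

theorem length_quotient_map {f : M →ₗ[R] M'} (hf : Function.Injective f) (N P : Submodule R M) :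
    Module.length R (N.map f ⧸ (P.map f).submoduleOf (N.map f)) =
      Module.length R (N ⧸ P.submoduleOf N) := by
  refine (LinearEquiv.length_eq (Submodule.Quotient.equiv _ _
    (Submodule.equivMapOfInjective f hf N) ?_)).symm
  ext ⟨_, w, hw, rfl⟩
  constructor
  · rintro ⟨v, hv, hvw⟩
    exact ⟨v, hv, congrArg Subtype.val hvw⟩
  · rintro ⟨v, hv, hvw⟩
    exact ⟨⟨w, hw⟩, hf hvw ▸ hv, rfl⟩

theorem quotLength_map {f : M →ₗ[R] M'} (hf : Function.Injective f) (N P : Submodule R M) :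
    quotLength (N.map f) (P.map f) = quotLength N P := by
  rw [quotLength, length_quotient_map hf, quotLength]

theorem length_quotient_pow_smul {a : R} (ha : Function.Injective fun z : M => a • z)
    (N : Submodule R M) (k : ℕ) :
    Module.length R (N ⧸ (a ^ k • N).submoduleOf N) =
      k * Module.length R (N ⧸ (a • N).submoduleOf N) := by
  induction k with
  | zero =>
    rw [pow_zero, one_smul, Submodule.submoduleOf_self, Nat.cast_zero, zero_mul,
      Module.length_eq_zero_iff, Submodule.Quotient.subsingleton_iff]
  | succ k ih =>
    have hstep : Module.length R (↥(a • N) ⧸ (a ^ (k + 1) • N).submoduleOf (a • N)) =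
        Module.length R (N ⧸ (a ^ k • N).submoduleOf N) := by
      rw [pow_succ', mul_smul]
      exact length_quotient_map (f := DistribSMul.toLinearMap R M a) ha N (a ^ k • N)
    have hle : a ^ (k + 1) • N ≤ a • N := by
      rw [pow_succ', mul_smul]
      exact smul_mono_right a (Submodule.smul_le_self_of_tower _ _)
    rw [length_quotient_add hle (Submodule.smul_le_self_of_tower a N), hstep, ih, Nat.cast_succ,
      add_one_mul]

theorem quotLength_pow_smul {a : R} (ha : Function.Injective fun z : M => a • z)
    (N : Submodule R M) (k : ℕ) : quotLength N (a ^ k • N) = k * quotLength N (a • N) := by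
  rw [quotLength, length_quotient_pow_smul ha, ENat.toNat_mul, ENat.toNat_natCast, quotLength]

theorem quotLength_smul_smul {a : R} (ha : Function.Injective fun z : M => a • z)
    (N P : Submodule R M) : quotLength (a • N) (a • P) = quotLength N P :=
  quotLength_map (f := DistribSMul.toLinearMap R M a) ha N P

theorem length_quotient_ne_top_of_pow_smul_le [IsLocalRing R] [IsNoetherianRing R]
    {P L : Submodule R M} (hL : L.FG) {k : ℕ} (h : maximalIdeal R ^ k • L ≤ P) :
    Module.length R (L ⧸ P.submoduleOf L) ≠ ⊤ := by
  let I := maximalIdeal R ^ (k + 1)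
  have hI : maximalIdeal R ∈ I.minimalPrimes :=
    ⟨⟨inferInstance, Ideal.pow_le_self k.succ_ne_zero⟩, fun J hJ _ => hJ.1.le_of_pow_le hJ.2⟩
  have hArtin := quotient_artinian_of_mem_minimalPrimes_of_isLocalRing I hI
  have htors : Module.IsTorsionBySet R (L ⧸ P.submoduleOf L) I := by
    refine (Module.isTorsionBySet_quotient_iff _ _).2 fun z a ha => h ?_
    exact Submodule.smul_mem_smul (Ideal.pow_le_pow_right k.le_succ ha) z.2
  let := htors.module
  have : IsScalarTower R (R ⧸ I) (L ⧸ P.submoduleOf L) := htors.isScalarTower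
  have : Module.Finite R L := Module.Finite.iff_fg.2 hL
  have : Module.Finite (R ⧸ I) (L ⧸ P.submoduleOf L) := .of_restrictScalars_finite R _ _
  rw [Module.length_eq_of_surjective (R := R ⧸ I) Ideal.Quotient.mk_surjective]
  exact Module.length_ne_top

end Length

section Reduction

variable {R : Type*} [CommRing R] {I : Ideal R} {x : R}

theorem pow_add_eq_span_pow_mul_pow {k : ℕ}
    (h : ∀ n ≥ k, I ^ (n + 1) = Ideal.span {x} * I ^ n) (j : ℕ) :
    I ^ (k + j) = Ideal.span {x ^ j} * I ^ k := by
  induction j with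
  | zero => rw [add_zero, pow_zero, Ideal.span_singleton_one, Ideal.top_mul]
  | succ j ih =>
    rw [← add_assoc, h _ (k.le_add_right j), ih, ← mul_assoc,
      Ideal.span_singleton_mul_span_singleton, pow_succ']

theorem IsMinimalReduction.ne_zero [IsDomain R] (hx : IsMinimalReduction I x) (hI : I ≠ ⊥) :
    x ≠ 0 := by
  rintro rfl
  obtain ⟨-, N, hN⟩ := hx
  have hzero : I ^ (N + 1) = ⊥ := by rw [hN N le_rfl, Ideal.span_singleton_zero, Ideal.bot_mul]
  exact hI (eq_zero_of_pow_eq_zero hzero)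

theorem IsMinimalReduction.reductionExponent_le_iff (hx : IsMinimalReduction I x) {k : ℕ} :
    reductionExponent I x ≤ k ↔ ∀ n ≥ k, I ^ (n + 1) = Ideal.span {x} * I ^ n :=
  ⟨fun hk n hn => Nat.sInf_mem hx.2 n (hk.trans hn), fun h => Nat.sInf_le h⟩

theorem not_pow_le_pow_succ [IsDomain R] [IsNoetherianRing R] (hbot : I ≠ ⊥) (htop : I ≠ ⊤)
    (k : ℕ) : ¬ I ^ k ≤ I ^ (k + 1) := by
  intro hle
  obtain ⟨r, hr, hrI⟩ := Submodule.exists_sub_one_mem_and_smul_eq_zero_of_fg_of_le_smul I (I ^ k)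
    (IsNoetherian.noetherian _) (by rwa [smul_eq_mul, ← pow_succ'])
  obtain ⟨a, ha, ha0⟩ := Submodule.exists_mem_ne_zero_of_ne_bot (pow_ne_zero k hbot)
  obtain rfl : r = 0 := (mul_eq_zero.1 (hrI a ha)).resolve_right ha0
  exact htop ((Ideal.eq_top_iff_one I).2 (by simpa using hr))

end Reduction

section Hilbert

variable {R : Type*} [CommRing R] {I : Ideal R}

theorem hPolynomial_eq {h : ℤ[X]}
    (hh : (h : PowerSeries ℤ) = (1 - PowerSeries.X) * hilbertSeries I) : hPolynomial I = h := by
  have hex : ∃ h : ℤ[X], (h : PowerSeries ℤ) = (1 - PowerSeries.X) * hilbertSeries I := ⟨h, hh⟩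
  rw [hPolynomial, dif_pos hex]
  exact Polynomial.coe_injective ℤ (hex.choose_spec.trans hh.symm)

theorem coe_eq_one_sub_X_mul_of_coeff_eq {A : Type*} [CommRing A] {f : PowerSeries A} {E : A}
    {N : ℕ} (hf : ∀ n ≥ N, PowerSeries.coeff n f = E) :
    (((1 - X) * f.trunc N + C E * X ^ N : A[X]) : PowerSeries A) = (1 - PowerSeries.X) * f := by
  have hsplit :
      f = (f.trunc N : PowerSeries A) + PowerSeries.C E * PowerSeries.X ^ N * PowerSeries.mk 1 := by
    ext n
    rw [map_add, mul_right_comm, PowerSeries.coeff_mul_X_pow', Polynomial.coeff_coe,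
      PowerSeries.coeff_trunc]
    rcases lt_or_ge n N with hn | hn
    · rw [if_pos hn, if_neg hn.not_ge, add_zero]
    · rw [if_neg hn.not_gt, if_pos hn, hf n hn, zero_add, PowerSeries.coeff_C_mul,
        PowerSeries.coeff_mk, Pi.one_apply, mul_one]
  have hgeom : PowerSeries.mk 1 * (1 - PowerSeries.X : PowerSeries A) = 1 :=
    PowerSeries.mk_one_mul_one_sub_eq_one A
  push_cast
  linear_combination (PowerSeries.X - 1) * hsplit - PowerSeries.C E * PowerSeries.X ^ N * hgeom

theorem multiplicity_eq_of_hilbertFunction_eq {E N : ℕ} (h : ∀ n ≥ N, hilbertFunction I n = E) :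
    multiplicity I = E := by
  have hcoeff : ∀ n ≥ N, PowerSeries.coeff n (hilbertSeries I) = (E : ℤ) := fun n hn => by
    rw [hilbertSeries, PowerSeries.coeff_mk, h n hn]
  rw [multiplicity, hPolynomial_eq (coe_eq_one_sub_X_mul_of_coeff_eq hcoeff)]
  simp

end Hilbert

section Fractional

variable {R K : Type*} [CommRing R] [Field K] [Algebra R K] {I J : Ideal R} {a x : R}

theorem mul_mem_smul_Rbar {r z : K} (hr : r ∈ Rbar R K) (hz : z ∈ a • Rbar R K) :
    r * z ∈ a • Rbar R K := by
  obtain ⟨s, hs, rfl⟩ := hz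
  exact ⟨r * s, IsIntegral.mul hr hs, (mul_smul_comm a r s).symm⟩

theorem one_le_Rbar : (1 : Submodule R K) ≤ Rbar R K :=
  Submodule.one_le.2 isIntegral_one

theorem conductor_le_one : conductor R K ≤ 1 := fun z hz => by
  simpa only [mul_one] using Submodule.mem_div_iff_forall_mul_mem.1 hz 1 isIntegral_one

theorem smul_Rbar_le_one_of_mem_conductor (ha : algebraMap R K a ∈ conductor R K) :
    a • Rbar R K ≤ 1 := by
  rintro _ ⟨r, hr, rfl⟩
  rw [DistribSMul.toLinearMap_apply, Algebra.smul_def]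
  exact Submodule.mem_div_iff_forall_mul_mem.1 ha r hr

theorem smul_Rbar_le_conductor_of_le_one (h : a • Rbar R K ≤ 1) :
    a • Rbar R K ≤ conductor R K :=
  Submodule.le_div_iff_mul_le.2 <| Submodule.mul_le.2 fun z hz r hr =>
    h (mul_comm r z ▸ mul_mem_smul_Rbar hr hz)

theorem div_self_le_Rbar {M : Submodule R K} (hbot : M ≠ ⊥) (hfg : M.FG) : M / M ≤ Rbar R K :=
  fun z hz => isIntegral_of_smul_mem_submodule M hbot hfg z
    (Submodule.mem_div_iff_forall_mul_mem.1 hz)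

theorem toK_le_one (I : Ideal R) : toK K I ≤ 1 := by
  rw [← IsLocalization.coeSubmodule_top (R := R) K]
  exact IsLocalization.coeSubmodule_mono K le_top

theorem toK_le_conductor_of_eq (h : toK K I = a • Rbar R K) : toK K I ≤ conductor R K :=
  h.trans_le (smul_Rbar_le_conductor_of_le_one (h ▸ toK_le_one I))

theorem Rbar_le_blowup_of_eq {n : ℕ} (h : toK K (I ^ n) = a • Rbar R K) :
    Rbar R K ≤ blowup K I :=
  fun r hr => Submodule.mem_iSup_of_mem n <| Submodule.mem_div_iff_forall_mul_mem.2 fun z hz => by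
    rw [h] at hz ⊢
    exact mul_mem_smul_Rbar hr hz

theorem toK_span_singleton_mul (a : R) (I : Ideal R) :
    toK K (Ideal.span {a} * I) = a • toK K I := by
  rw [← smul_eq_mul, Submodule.ideal_span_singleton_smul]
  exact Submodule.map_pointwise_smul a I (Algebra.linearMap R K)

theorem pow_smul_toK_pow_le (hxI : x ∈ I) (j n : ℕ) :
    x ^ j • toK K (I ^ n) ≤ toK K (I ^ (j + n)) := by
  rw [← toK_span_singleton_mul, pow_add]
  refine IsLocalization.coeSubmodule_mono K (Ideal.mul_mono_left ?_)
  exact (Ideal.span_singleton_le_iff_mem _).2 (Ideal.pow_mem_pow hxI j)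

variable [FaithfulSMul R K]

theorem toK_injective : Function.Injective (toK K : Ideal R → Submodule R K) :=
  Submodule.map_injective_of_injective (FaithfulSMul.algebraMap_injective R K)

theorem toK_le_toK_iff : toK K I ≤ toK K J ↔ I ≤ J :=
  Submodule.map_le_map_iff_of_injective (FaithfulSMul.algebraMap_injective R K) I J

theorem quotLength_toK (I J : Ideal R) : quotLength (toK K I) (toK K J) = quotLength I J :=
  quotLength_map (f := Algebra.linearMap R K) (FaithfulSMul.algebraMap_injective R K) I J

variable [IsDomain R]

theorem smul_mem_smul_iff (ha : a ≠ 0) {M : Submodule R K} {z : K} : a • z ∈ a • M ↔ z ∈ M :=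
  (smul_right_injective K ha).mem_set_image

theorem toK_pow_div_self_le_Rbar [IsNoetherianRing R] (hI : I ≠ ⊥) (n : ℕ) :
    toK K (I ^ n) / toK K (I ^ n) ≤ Rbar R K := by
  refine div_self_le_Rbar (fun h => pow_ne_zero n hI (toK_injective (h.trans ?_)))
    (Submodule.FG.map _ (IsNoetherian.noetherian _))
  exact (IsLocalization.coeSubmodule_bot K).symm

theorem blowup_le_Rbar [IsNoetherianRing R] (hI : I ≠ ⊥) : blowup K I ≤ Rbar R K :=
  iSup_le (toK_pow_div_self_le_Rbar hI)

end Fractional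

section Stability

variable {R K : Type*} [CommRing R] [IsDomain R] [Field K] [Algebra R K] [FaithfulSMul R K]
  [IsNoetherianRing R] {I : Ideal R} {x : R} {k : ℕ}

namespace IsMinimalReduction

theorem toK_pow_le (hx : IsMinimalReduction I x) (hI : I ≠ ⊥) (k : ℕ) :
    toK K (I ^ k) ≤ x ^ k • Rbar R K := by
  have hxk : x ^ k ≠ 0 := pow_ne_zero k (hx.ne_zero hI)
  obtain ⟨N, hN⟩ := hx.2
  intro z hz
  obtain ⟨r, rfl⟩ : ∃ r : K, x ^ k • r = z := by
    have hxk' : algebraMap R K (x ^ k) ≠ 0 := (FaithfulSMul.algebraMap_eq_zero_iff R K).not.2 hxk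
    exact ⟨(algebraMap R K (x ^ k))⁻¹ * z, by rw [Algebra.smul_def, mul_inv_cancel_left₀ hxk']⟩
  refine (smul_mem_smul_iff hxk).2 (toK_pow_div_self_le_Rbar hI N ?_)
  refine Submodule.mem_div_iff_forall_mul_mem.2 fun w hw => ?_
  rw [← smul_mem_smul_iff hxk, ← toK_span_singleton_mul, ← pow_add_eq_span_pow_mul_pow hN,
    ← smul_mul_assoc, add_comm, pow_add, toK, IsLocalization.coeSubmodule_mul]
  exact Submodule.mul_mem_mul hz hw

theorem toK_pow_eq_of_le (hx : IsMinimalReduction I x) (hI : I ≠ ⊥)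
    (hk : toK K (I ^ k) = x ^ k • Rbar R K) {n : ℕ} (hn : k ≤ n) :
    toK K (I ^ n) = x ^ n • Rbar R K := by
  obtain ⟨j, rfl⟩ := Nat.exists_eq_add_of_le' hn
  refine le_antisymm (hx.toK_pow_le hI _) ?_
  rw [pow_add, mul_smul, ← hk]
  exact pow_smul_toK_pow_le hx.1 j k

theorem toK_pow_eq_iff (hx : IsMinimalReduction I x) (hI : I ≠ ⊥) :
    toK K (I ^ k) = x ^ k • Rbar R K ↔ blowup K I = Rbar R K ∧ reductionExponent I x ≤ k := by
  rw [hx.reductionExponent_le_iff]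
  constructor
  · intro hk
    refine ⟨le_antisymm (blowup_le_Rbar hI) (Rbar_le_blowup_of_eq hk), fun n hn => ?_⟩
    apply toK_injective (K := K)
    rw [toK_span_singleton_mul, hx.toK_pow_eq_of_le hI hk hn,
      hx.toK_pow_eq_of_le hI hk (hn.trans n.le_succ), pow_succ', mul_smul]
  · rintro ⟨hblowup, hk⟩
    refine le_antisymm (hx.toK_pow_le hI k) ?_
    rintro _ ⟨r, hr, rfl⟩
    have hr' : r ∈ (blowup K I : Set K) := hblowup ▸ hr
    obtain ⟨n, hn⟩ := Set.mem_iUnion.1 (coe_blowup K I ▸ hr')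
    have hxr : x ^ n • r ∈ toK K (I ^ n) := by
      rw [Algebra.smul_def, mul_comm]
      exact Submodule.mem_div_iff_forall_mul_mem.1 hn _ ⟨_, Ideal.pow_mem_pow hx.1 n, rfl⟩
    have hxkr : x ^ k • x ^ n • r ∈ toK K (I ^ (k + n)) :=
      pow_smul_toK_pow_le hx.1 k n (Submodule.smul_mem_pointwise_smul _ _ _ hxr)
    rwa [pow_add_eq_span_pow_mul_pow hk, toK_span_singleton_mul, smul_comm,
      smul_mem_smul_iff (pow_ne_zero n (hx.ne_zero hI))] at hxkr

theorem toK_pow_eq_of_conductor_eq (hx : IsMinimalReduction I x) (hI : I ≠ ⊥)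
    (h : conductor R K = toK K (I ^ k)) : toK K (I ^ k) = x ^ k • Rbar R K := by
  have hmem : algebraMap R K (x ^ k) ∈ conductor R K :=
    h ▸ ⟨x ^ k, Ideal.pow_mem_pow hx.1 k, rfl⟩
  refine le_antisymm (hx.toK_pow_le hI k) ?_
  rw [← h]
  exact smul_Rbar_le_conductor_of_le_one (smul_Rbar_le_one_of_mem_conductor hmem)

theorem reductionExponent_eq_of_conductor_eq (hx : IsMinimalReduction I x) (hbot : I ≠ ⊥)
    (htop : I ≠ ⊤) (h : conductor R K = toK K (I ^ k)) : reductionExponent I x = k := by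
  obtain ⟨hblowup, hle⟩ := (hx.toK_pow_eq_iff hbot).1 (hx.toK_pow_eq_of_conductor_eq hbot h)
  refine hle.antisymm (not_lt.1 fun hlt => ?_)
  obtain ⟨j, rfl⟩ := Nat.exists_eq_add_of_le' (Nat.one_le_of_lt hlt)
  have hj : toK K (I ^ j) = x ^ j • Rbar R K :=
    (hx.toK_pow_eq_iff hbot).2 ⟨hblowup, Nat.lt_succ_iff.1 hlt⟩
  exact not_pow_le_pow_succ hbot htop j
    (toK_le_toK_iff.1 ((toK_le_conductor_of_eq hj).trans h.le))

theorem multiplicity_eq_quotLength (hx : IsMinimalReduction I x) (hI : I ≠ ⊥)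
    (hk : toK K (I ^ k) = x ^ k • Rbar R K) :
    multiplicity I = quotLength (Rbar R K) (x • Rbar R K) := by
  refine multiplicity_eq_of_hilbertFunction_eq (N := k) fun n hn => ?_
  rw [hilbertFunction, ← quotLength_toK (K := K), hx.toK_pow_eq_of_le hI hk hn,
    hx.toK_pow_eq_of_le hI hk (hn.trans n.le_succ), pow_succ, mul_smul,
    quotLength_smul_smul (smul_right_injective K (pow_ne_zero n (hx.ne_zero hI)))]

theorem quotLength_toK_pow (hx : IsMinimalReduction I x) (hI : I ≠ ⊥)
    (hk : toK K (I ^ k) = x ^ k • Rbar R K) :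
    (quotLength (Rbar R K) (toK K (I ^ k)) : ℤ) = k * multiplicity I := by
  rw [hx.multiplicity_eq_quotLength hI hk, hk,
    quotLength_pow_smul (smul_right_injective K (hx.ne_zero hI)), Nat.cast_mul]

end IsMinimalReduction

end Stability

section IsLocalRing

variable {R K : Type*} [CommRing R] [IsDomain R] [IsLocalRing R] [IsNoetherianRing R]
  [Field K] [Algebra R K] [FaithfulSMul R K] {a x : R} {k : ℕ}

theorem length_Rbar_quotient_toK_pow_ne_top (ha : a ≠ 0)
    (h : toK K (maximalIdeal R ^ k) = a • Rbar R K) :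
    Module.length R (Rbar R K ⧸ (toK K (maximalIdeal R ^ k)).submoduleOf (Rbar R K)) ≠ ⊤ := by
  have hfg : (Rbar R K).FG := by
    refine Submodule.fg_of_fg_map_injective (DistribSMul.toLinearMap R K a)
      (smul_right_injective K ha) (?_ : (a • Rbar R K).FG)
    exact h ▸ Submodule.FG.map _ (IsNoetherian.noetherian _)
  refine length_quotient_ne_top_of_pow_smul_le (k := k) hfg ?_
  refine Submodule.smul_le.2 fun b hb r hr => ?_
  have hbK : algebraMap R K b ∈ toK K (maximalIdeal R ^ k) := ⟨b, hb, rfl⟩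
  rw [h] at hbK ⊢
  rw [Algebra.smul_def, mul_comm]
  exact mul_mem_smul_Rbar hr hbK

theorem quotLength_toK_maximalIdeal_sq (ha : a ≠ 0)
    (h : toK K (maximalIdeal R ^ 2) = a • Rbar R K) :
    quotLength (Rbar R K) (toK K (maximalIdeal R ^ 2)) =
      embDim R + 1 + singularityDegree R K := by
  have hresidue : quotLength 1 (toK K (maximalIdeal R)) = 1 := by
    rw [← IsLocalization.coeSubmodule_top (R := R) K, quotLength_toK]
    exact quotLength_eq_one_of_covBy (covBy_top_iff.2 (maximalIdeal.isMaximal R).out)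
  have hle : toK K (maximalIdeal R ^ 2) ≤ toK K (maximalIdeal R) :=
    toK_le_toK_iff.2 (Ideal.pow_le_self two_ne_zero)
  have hfin := length_Rbar_quotient_toK_pow_ne_top ha h
  have hfin' := ((length_quotient_ne_top_iff (toK_le_one _) one_le_Rbar).1 hfin).1
  rw [quotLength_add (toK_le_one _) one_le_Rbar hfin, quotLength_add hle (toK_le_one _) hfin',
    hresidue, quotLength_toK, embDim, singularityDegree]

theorem IsMinimalReduction.two_mul_multiplicity_eq (hx : IsMinimalReduction (maximalIdeal R) x)
    (hm : maximalIdeal R ≠ ⊥) (h : toK K (maximalIdeal R ^ 2) = x ^ 2 • Rbar R K) :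
    2 * multiplicity (maximalIdeal R) = embDim R + 1 + singularityDegree R K := by
  rw [← Nat.cast_ofNat, ← hx.quotLength_toK_pow hm h,
    quotLength_toK_maximalIdeal_sq (pow_ne_zero 2 (hx.ne_zero hm)) h]
  norm_cast

theorem IsMinimalReduction.conductorExponent_eq_iff (hx : IsMinimalReduction (maximalIdeal R) x)
    (hm : maximalIdeal R ≠ ⊥) (hk : toK K (maximalIdeal R ^ k) = x ^ k • Rbar R K) :
    (conductorExponent R K : ℤ) = k * multiplicity (maximalIdeal R) ↔
      conductor R K = toK K (maximalIdeal R ^ k) := by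
  rw [← hx.quotLength_toK_pow hm hk, Nat.cast_inj, conductorExponent, eq_comm,
    quotLength_eq_quotLength_iff (toK_le_conductor_of_eq hk) (conductor_le_one.trans one_le_Rbar)
      (length_Rbar_quotient_toK_pow_ne_top (pow_ne_zero k (hx.ne_zero hm)) hk), eq_comm]

end IsLocalRing

end BlowUp

open BlowUp IsLocalRing in
open scoped Pointwise in
theorem proposition6p11_general {R K : Type*} [CommRing R] [IsDomain R] [IsLocalRing R]
    [IsNoetherianRing R] [Field K] [Algebra R K] [FaithfulSMul R K]
    (hm : maximalIdeal R ≠ ⊥) {x : R} (hx : IsMinimalReduction (maximalIdeal R) x) :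
    conductor R K = toK K (maximalIdeal R ^ 2) ↔
      (blowup K (maximalIdeal R) = Rbar R K ∧
        (multiplicity (maximalIdeal R) : ℚ) - ((embDim R : ℚ) + 1) =
          (2 * (singularityDegree R K : ℚ) - (conductorExponent R K : ℚ)) / 2 ∧
        reductionExponent (maximalIdeal R) x = 2) := by
  by_cases hstable : toK K (maximalIdeal R ^ 2) = x ^ 2 • Rbar R K
  · have hnumeric : (multiplicity (maximalIdeal R) : ℚ) - ((embDim R : ℚ) + 1) =
          (2 * (singularityDegree R K : ℚ) - (conductorExponent R K : ℚ)) / 2 ↔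
        conductor R K = toK K (maximalIdeal R ^ 2) := by
      have hmult : 2 * (multiplicity (maximalIdeal R) : ℚ) =
          embDim R + 1 + singularityDegree R K := mod_cast hx.two_mul_multiplicity_eq hm hstable
      rw [← hx.conductorExponent_eq_iff hm hstable, ← Int.cast_inj (α := ℚ)]
      push_cast
      constructor <;> intro h <;> linarith
    rw [hnumeric]
    exact ⟨fun h => ⟨((hx.toK_pow_eq_iff hm).1 hstable).1, h,
      hx.reductionExponent_eq_of_conductor_eq hm Ideal.IsPrime.ne_top' h⟩, fun h => h.2.1⟩
  · exact iff_of_false (fun h => hstable (hx.toK_pow_eq_of_conductor_eq hm h))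
      fun h => hstable ((hx.toK_pow_eq_iff hm).2 ⟨h.1, h.2.2.le⟩)

theorem proposition6p11 {R K : Type*} [CommRing R] [IsDomain R] [IsLocalRing R]
    [IsNoetherianRing R] (hdim : ringKrullDim R = 1)
    [Infinite (IsLocalRing.ResidueField R)]
    [Field K] [Algebra R K] [IsFractionRing R K]
    [Module.Finite R (integralClosure R K)]
    [IsDiscreteValuationRing (integralClosure R K)]
    (hres : BlowUp.IsResiduallyRational R K)
    (hnp : ¬ (IsLocalRing.maximalIdeal R).IsPrincipal)
    (x : R) (hx : BlowUp.IsMinimalReduction (IsLocalRing.maximalIdeal R) x) :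
    BlowUp.conductor R K = BlowUp.toK K (IsLocalRing.maximalIdeal R ^ 2) ↔
      (BlowUp.blowup K (IsLocalRing.maximalIdeal R) = BlowUp.Rbar R K ∧
        (BlowUp.multiplicity (IsLocalRing.maximalIdeal R) : ℚ) - ((BlowUp.embDim R : ℚ) + 1) =
          (2 * (BlowUp.singularityDegree R K : ℚ) - (BlowUp.conductorExponent R K : ℚ)) / 2 ∧
        BlowUp.reductionExponent (IsLocalRing.maximalIdeal R) x = 2) :=
  proposition6p11_general (fun hm => hnp (hm ▸ inferInstance)) hx
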